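/- Let $A$ be a $C^*$-algebra (not necessarily unital). Ideals are closed and two-sided; for subsets, $\overline{XYZ}$ denotes the closed linear span of $\{xyz: x\in X,y\in Y,z\in Z\}$, and $I^\perp=\{a\in A: aI=\{0\}\}$ for $I\subseteq A$. An \emph{Exel system} $(A,\alpha,L)$ consists of a $*$-endomorphism $\alpha:A\to A$ and a positive linear map $L:A\to A$ with $L(a\alpha(b))=L(a)b$ for all $a,b\in A$ (then $L$ is automatically completely positive). It is \emph{regular} if $\alpha\circ L$ is a conditional expectation (contractive linear idempotent) onto $\alpha(A)$. The map $L$ is \emph{faithful} on a $C^*$-subalgebra $C\subseteq A$ if $a\in C$, $L(a^*a)=0$ imply $a=0$. The multiplicative domain of $L$ is $MD(L)=\{a\in A: L(b)L(a)=L(ba),\ L(a)L(b)=L(ab)\ \forall b\in A\}$; $\ker L|_{MD(L)}$ is an ideal of the $C^*$-algebra $MD(L)$, and $(\ker L|_{MD(L)})^\perp$ denotes its annihilator in $MD(L)$. The GNS-kernel of $L$ is $N_L=\{a\in A: L((ab)^*ab)=0\ \forall b\in A\}$. A \emph{representation} of $(A,L)$ is a pair $(\pi,S)$ of a non-degenerate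 representation $\pi:A\to B(H)$ on a Hilbert space and $S\in B(H)$ with $S^*\pi(a)S=\pi(L(a))$ for all $a\in A$; it is a representation of $(A,\alpha,L)$ if moreover $S\pi(a)=\pi(\alpha(a))S$ for all $a\in A$. In each case let $(i_A,t)$ be the universal representation and let the Toeplitz algebra $\mathcal T(A,L)$, respectively $\mathcal T(A,\alpha,L)$, be the $C^*$-algebra generated by $i_A(A)\cup i_A(A)t$. A \emph{redundancy} is a pair $(i_A(a),k)$ with $a\in A$, $i_A(a)i_A(b)t=k\,i_A(b)t$ for all $b\in A$, and $k\in\overline{i_A(A)t\,i_A(A)t^*i_A(A)}$ in the case of $(A,L)$, respectively $k\in\overline{i_A(A)tt^*i_A(A)}$ in the case of $(A,\alpha,L)$. For an ideal $J$ of $A$, $C^*(A,L;J)$ is the quotient of $\mathcal T(A,L)$ by the ideal generated by all $i_A(a)-k$ with $a\in J$ and $(i_A(a),k)$ a redundancy; $C^*(A,L):=C^*(A,L;N_L^\perp)$. Exel's crossed product $A\times_{\alpha,L}\mathbb N$ is the quotient of $\mathcal T(A,\alpha,L)$ by the ideal generated by all $i_A(a)-k$ with $a\in\overline{A\alpha(A)A}$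 and $(i_A(a),k)$ a redundancy. Equality of two such algebras means that there is a $*$-isomorphism between them that sends the images of $i_A(a)$ and $i_A(a)t$ in one to the images of $i_A(a)$ and $i_A(a)t$ in the other, for every $a\in A$. \textbf{Proposition.} Let $(A,\alpha,L)$ be a regular Exel system such that $L$ is faithful on $\overline{A\alpha(A)A}$. Then $$\alpha(A)=(\ker L|_{MD(L)})^\perp .$$ Hence $\alpha$ is uniquely determined by $L$: if $(A,\alpha',L)$ is a regular Exel system with $L$ faithful on $\overline{A\alpha'(A)A}$, then $\alpha'=\alpha$. Moreover, $$A\times_{\alpha,L}\mathbb N=C^*\big(A,L;\overline{A(\ker L|_{MD(L)})^\perp A}\big).$$ In particular, if $\overline{A(\ker L|_{MD(L)})^\perp A}=N_L^\perp$, then $A\times_{\alpha,L}\mathbb N=C^*(A,L)$. -/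

import Mathlib

open scoped ENNReal Topology

universe u

noncomputable section

namespace ExelCrossed

/-! ### Quotients of C*-algebras by closed two-sided ideals -/

/-- A closed two-sided ideal of a C*-algebra.  Self-adjointness, which holds automatically for closed
two-sided ideals of a C*-algebra, is recorded as a field. -/
structure ClosedIdeal (B : Type*) [NonUnitalCStarAlgebra B] extends Submodule ℂ B where
  mul_left' : ∀ (b : B) {x : B}, x ∈ carrier → b * x ∈ carrier
  mul_right' : ∀ (b : B) {x : B}, x ∈ carrier → x * b ∈ carrier
  star' : ∀ {x : B}, x ∈ carrier → star x ∈ carrier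
  isClosed' : IsClosed carrier

/-- The closed two-sided ideal generated by a set: the intersection of all those containing it. -/
def ClosedIdeal.generate {B : Type*} [NonUnitalCStarAlgebra B] (X : Set B) : ClosedIdeal B where
  carrier := {z | ∀ I : ClosedIdeal B, X ⊆ I.carrier → z ∈ I.carrier}
  add_mem' hx hy I hI := I.add_mem' (hx I hI) (hy I hI)
  zero_mem' I _ := I.zero_mem'
  smul_mem' c _ hx I hI := I.smul_mem' c (hx I hI)
  mul_left' b _ hx I hI := I.mul_left' b (hx I hI)
  mul_right' b _ hx I hI := I.mul_right' b (hx I hI)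
  star' hx I hI := I.star' (hx I hI)
  isClosed' := by
    have h : {z : B | ∀ I : ClosedIdeal B, X ⊆ I.carrier → z ∈ I.carrier} =
        ⋂ (I : ClosedIdeal B) (_ : X ⊆ I.carrier), I.carrier := by
      ext z; simp
    change IsClosed {z : B | ∀ I : ClosedIdeal B, X ⊆ I.carrier → z ∈ I.carrier}
    rw [h]
    exact isClosed_iInter fun I => isClosed_iInter fun _ => I.isClosed'

section Quotient

variable {B : Type*} [NonUnitalCStarAlgebra B]

/-- The quotient C*-algebra `B / I`, with the quotient operations and the quotient norm. -/
def CStarQuotient (I : ClosedIdeal B) : Type _ := B ⧸ I.toSubmodule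

namespace CStarQuotient

variable (I : ClosedIdeal B)

/-- The quotient map `B → B / I`. -/
def mk (b : B) : CStarQuotient I := Submodule.Quotient.mk b

instance : NormedAddCommGroup (CStarQuotient I) :=
  haveI : IsClosed (I.toSubmodule : Set B) := I.isClosed'
  inferInstanceAs (NormedAddCommGroup (B ⧸ I.toSubmodule))

instance : NormedSpace ℂ (CStarQuotient I) :=
  inferInstanceAs (NormedSpace ℂ (B ⧸ I.toSubmodule))

instance : CompleteSpace (CStarQuotient I) :=
  inferInstanceAs (CompleteSpace (B ⧸ I.toSubmodule))

variable {I}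

theorem mk_surjective : Function.Surjective (mk I) := Submodule.Quotient.mk_surjective _

theorem mk_eq_mk {x y : B} : mk I x = mk I y ↔ x - y ∈ I.carrier :=
  Submodule.Quotient.eq I.toSubmodule

variable (I)

instance : Mul (CStarQuotient I) where
  mul := Quotient.map₂ (· * ·) fun a a' h b b' h' => by
    have h1 : a - a' ∈ I.carrier := (Submodule.quotientRel_def I.toSubmodule).1 h
    have h2 : b - b' ∈ I.carrier := (Submodule.quotientRel_def I.toSubmodule).1 h'
    refine (Submodule.quotientRel_def I.toSubmodule).2 ?_
    have h3 : a * b - a' * b' = (a - a') * b + a' * (b - b') := by noncomm_ring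
    rw [h3]
    exact I.add_mem' (I.mul_right' b h1) (I.mul_left' a' h2)

instance : Star (CStarQuotient I) where
  star := Quotient.map star fun a a' h => by
    have h1 : a - a' ∈ I.carrier := (Submodule.quotientRel_def I.toSubmodule).1 h
    refine (Submodule.quotientRel_def I.toSubmodule).2 ?_
    rw [← star_sub]
    exact I.star' h1

theorem mk_mul (x y : B) : mk I (x * y) = mk I x * mk I y := rfl
theorem mk_add (x y : B) : mk I (x + y) = mk I x + mk I y := rfl
theorem mk_star (x : B) : mk I (star x) = star (mk I x) := rfl
theorem mk_zero : mk I 0 = 0 := rfl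
theorem mk_smul (c : ℂ) (x : B) : mk I (c • x) = c • mk I x := rfl

theorem norm_mk_le (x : B) : ‖mk I x‖ ≤ ‖x‖ := Submodule.Quotient.norm_mk_le I.toSubmodule x

theorem exists_norm_lt (X : CStarQuotient I) {ε : ℝ} (hε : 0 < ε) :
    ∃ x : B, mk I x = X ∧ ‖x‖ < ‖X‖ + ε :=
  Submodule.Quotient.norm_mk_lt (S := I.toSubmodule) X hε

instance : NonUnitalRing (CStarQuotient I) :=
  { (inferInstance : AddCommGroup (CStarQuotient I)),
    (inferInstance : Mul (CStarQuotient I)) with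
    left_distrib := fun a b c => by
      obtain ⟨a, rfl⟩ := mk_surjective a
      obtain ⟨b, rfl⟩ := mk_surjective b
      obtain ⟨c, rfl⟩ := mk_surjective c
      simp only [← mk_mul, ← mk_add, mul_add]
    right_distrib := fun a b c => by
      obtain ⟨a, rfl⟩ := mk_surjective a
      obtain ⟨b, rfl⟩ := mk_surjective b
      obtain ⟨c, rfl⟩ := mk_surjective c
      simp only [← mk_mul, ← mk_add, add_mul]
    zero_mul := fun a => by
      obtain ⟨a, rfl⟩ := mk_surjective a
      change mk I 0 * mk I a = mk I 0
      rw [← mk_mul, zero_mul]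
    mul_zero := fun a => by
      obtain ⟨a, rfl⟩ := mk_surjective a
      change mk I a * mk I 0 = mk I 0
      rw [← mk_mul, mul_zero]
    mul_assoc := fun a b c => by
      obtain ⟨a, rfl⟩ := mk_surjective a
      obtain ⟨b, rfl⟩ := mk_surjective b
      obtain ⟨c, rfl⟩ := mk_surjective c
      simp only [← mk_mul, mul_assoc] }

instance : NonUnitalNormedRing (CStarQuotient I) :=
  { (inferInstance : NormedAddCommGroup (CStarQuotient I)),
    (inferInstance : NonUnitalRing (CStarQuotient I)) with
    norm_mul_le := fun X Y => by
      have key : ∀ ε > 0, ‖X * Y‖ ≤ (‖X‖ + ε) * (‖Y‖ + ε) := fun ε hε => by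
        obtain ⟨x, rfl, hx⟩ := exists_norm_lt I X hε
        obtain ⟨y, rfl, hy⟩ := exists_norm_lt I Y hε
        calc ‖mk I x * mk I y‖ ≤ ‖x * y‖ := norm_mk_le I (x * y)
          _ ≤ ‖x‖ * ‖y‖ := norm_mul_le x y
          _ ≤ _ := by gcongr
      have hlim : Filter.Tendsto (fun ε : ℝ => (‖X‖ + ε) * (‖Y‖ + ε)) (𝓝[>] 0)
          (𝓝 ((‖X‖ + 0) * (‖Y‖ + 0))) := by
        refine Filter.Tendsto.mono_left ?_ nhdsWithin_le_nhds
        exact Continuous.tendsto (by fun_prop) 0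
      rw [add_zero, add_zero] at hlim
      exact ge_of_tendsto hlim (by filter_upwards [self_mem_nhdsWithin] with ε hε using key ε hε) }

instance : StarRing (CStarQuotient I) where
  star_involutive a := by
    obtain ⟨a, rfl⟩ := mk_surjective a
    simp only [← mk_star, star_star]
  star_mul a b := by
    obtain ⟨a, rfl⟩ := mk_surjective a
    obtain ⟨b, rfl⟩ := mk_surjective b
    simp only [← mk_star, ← mk_mul, star_mul]
  star_add a b := by
    obtain ⟨a, rfl⟩ := mk_surjective a
    obtain ⟨b, rfl⟩ := mk_surjective b
    simp only [← mk_star, ← mk_add, star_add]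

instance : IsScalarTower ℂ (CStarQuotient I) (CStarQuotient I) where
  smul_assoc c a b := by
    obtain ⟨a, rfl⟩ := mk_surjective a
    obtain ⟨b, rfl⟩ := mk_surjective b
    simp only [smul_eq_mul, ← mk_smul, ← mk_mul, smul_mul_assoc]

instance : SMulCommClass ℂ (CStarQuotient I) (CStarQuotient I) where
  smul_comm c a b := by
    obtain ⟨a, rfl⟩ := mk_surjective a
    obtain ⟨b, rfl⟩ := mk_surjective b
    simp only [smul_eq_mul, ← mk_smul, ← mk_mul, mul_smul_comm]

instance : StarModule ℂ (CStarQuotient I) where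
  star_smul c a := by
    obtain ⟨a, rfl⟩ := mk_surjective a
    simp only [← mk_star, ← mk_smul, star_smul]

end CStarQuotient

theorem norm_sub_mul_le_of_square {b : B} (hb : ‖star b * b‖ ≤ 1) (m : B) :
    ‖m - star b * b * m‖ ≤ ‖m‖ := by
  let := CStarAlgebra.spectralOrder (Unitization ℂ B)
  have := CStarAlgebra.spectralOrderedRing (Unitization ℂ B)
  set e : Unitization ℂ B := star (b : Unitization ℂ B) * (b : Unitization ℂ B) with he
  have hinr : e = ((star b * b : B) : Unitization ℂ B) := by
    rw [he, Unitization.inr_mul, Unitization.inr_star]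
  have h0 : 0 ≤ e := star_mul_self_nonneg _
  have h1 : e ≤ 1 := by
    refine (CStarAlgebra.norm_le_one_iff_of_nonneg e h0).1 ?_
    rw [hinr, Unitization.norm_inr]
    exact hb
  have h2 : ‖1 - e‖ ≤ 1 := by
    refine (CStarAlgebra.norm_le_one_iff_of_nonneg (1 - e) (sub_nonneg.2 h1)).2 ?_
    exact sub_le_self 1 h0
  have h3 : ((m - star b * b * m : B) : Unitization ℂ B) = (1 - e) * (m : Unitization ℂ B) := by
    rw [hinr, sub_mul, one_mul, ← Unitization.inr_mul, Unitization.inr_sub]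
  rw [← Unitization.norm_inr (𝕜 := ℂ) (a := m - star b * b * m), h3,
    ← Unitization.norm_inr (𝕜 := ℂ) (a := m)]
  calc _ ≤ ‖1 - e‖ * ‖(m : Unitization ℂ B)‖ := norm_mul_le _ _
    _ ≤ 1 * ‖(m : Unitization ℂ B)‖ := by gcongr
    _ = _ := one_mul _

theorem ClosedIdeal.exists_approx (I : ClosedIdeal B) {z : B} (hz : z ∈ I.carrier) {δ : ℝ}
    (hδ : 0 < δ) : ∃ e ∈ I.carrier, star e = e ∧ (∀ m : B, ‖m - e * m‖ ≤ ‖m‖) ∧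
      ‖z - z * e‖ < δ := by
  let S : NonUnitalStarSubalgebra ℂ B :=
    { I.toSubmodule with
      mul_mem' := fun {a b} _ hb => I.mul_left' a hb
      star_mem' := fun {a} ha => I.star' ha }
  have : IsClosed (S : Set B) := I.isClosed'
  let := CStarAlgebra.spectralOrder S
  have := CStarAlgebra.spectralOrderedRing S
  have hu := CStarAlgebra.increasingApproximateUnit S
  have := hu.neBot
  have ht := (Metric.tendsto_nhds.1 (hu.tendsto_mul_left ⟨z, hz⟩)) δ hδ
  obtain ⟨e, ⟨he0, he1⟩, he2⟩ := ((hu.eventually_nonneg.and hu.eventually_norm).and ht).exists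
  obtain ⟨b, hb⟩ := CStarAlgebra.nonneg_iff_eq_star_mul_self.1 he0
  have hb' : (e : B) = star (b : B) * (b : B) := by rw [hb]; rfl
  refine ⟨e, e.2, ?_, ?_, ?_⟩
  · rw [hb', star_mul, star_star]
  · intro m
    have := norm_sub_mul_le_of_square (b := (b : B)) (by rw [← hb']; exact he1) m
    rwa [← hb'] at this
  · rw [dist_eq_norm, norm_sub_rev] at he2
    exact he2

instance (I : ClosedIdeal B) : CStarRing (CStarQuotient I) where
  norm_mul_self_le X := by
    refine le_of_forall_pos_le_add fun ε hε => ?_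
    obtain ⟨x, rfl⟩ := CStarQuotient.mk_surjective X
    obtain ⟨y, hy, hyn⟩ := CStarQuotient.exists_norm_lt I
      (star (CStarQuotient.mk I x) * CStarQuotient.mk I x) (half_pos hε)
    have hz : star x * x - y ∈ I.carrier := CStarQuotient.mk_eq_mk.1 hy.symm
    obtain ⟨e, heI, hes, hec, hez⟩ := I.exists_approx hz (half_pos hε)
    have hec' : ∀ m : B, ‖m - m * e‖ ≤ ‖m‖ := fun m => by
      have := hec (star m)
      rwa [← norm_star, star_sub, star_mul, star_star, hes, norm_star] at this
    have h1 : CStarQuotient.mk I x = CStarQuotient.mk I (x - x * e) := by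
      refine CStarQuotient.mk_eq_mk.2 ?_
      rw [sub_sub_cancel]
      exact I.mul_left' x heI
    have h2 : star (x - x * e) * (x - x * e) =
        ((star x * x - y) - (star x * x - y) * e) - e * ((star x * x - y) - (star x * x - y) * e) +
        ((y - y * e) - e * (y - y * e)) := by
      rw [star_sub, star_mul, hes]; noncomm_ring
    calc ‖CStarQuotient.mk I x‖ * ‖CStarQuotient.mk I x‖
        ≤ ‖x - x * e‖ * ‖x - x * e‖ := by
          rw [h1]; gcongr <;> exact CStarQuotient.norm_mk_le I _
      _ = ‖star (x - x * e) * (x - x * e)‖ := CStarRing.norm_star_mul_self.symm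
      _ ≤ ε / 2 + ‖y‖ := by
          rw [h2]
          refine (norm_add_le _ _).trans (add_le_add ?_ ?_)
          · exact (hec _).trans hez.le
          · exact (hec _).trans (hec' _)
      _ ≤ _ := by linarith

instance (I : ClosedIdeal B) : NonUnitalCStarAlgebra (CStarQuotient I) where

end Quotient

variable {A : Type u} [NonUnitalCStarAlgebra A] [PartialOrder A] [StarOrderedRing A]

/-! ### Representations of a positive map -/

/-- A representation `(π, S)` of `(A, φ)` on a Hilbert space `H`: a non-degenerate representation
`π : A → B(H)` and an operator `S ∈ B(H)` with `S* π(a) S = π(φ(a))` for all `a`. -/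
structure Rep (φ : A →ₚ[ℂ] A) : Type (u + 1) where
  H : Type u
  [normedAddCommGroup : NormedAddCommGroup H]
  [innerProductSpace : InnerProductSpace ℂ H]
  [completeSpace : CompleteSpace H]
  π : A →⋆ₙₐ[ℂ] (H →L[ℂ] H)
  nondegenerate : (Submodule.span ℂ {v : H | ∃ a h, v = π a h}).topologicalClosure = ⊤
  S : H →L[ℂ] H
  rel : ∀ a, star S * π a * S = π (φ a)

attribute [instance] Rep.normedAddCommGroup Rep.innerProductSpace Rep.completeSpace

/-- The operators `S` of all representations of `(A, φ)` are uniformly bounded. -/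
theorem Rep.exists_norm_S_le (φ : A →ₚ[ℂ] A) : ∃ C : ℝ, ∀ ρ : Rep φ, ‖ρ.S‖ ≤ C := by
  obtain ⟨C, hC⟩ := PositiveLinearMap.exists_norm_apply_le φ
  refine ⟨Real.sqrt C, fun ρ => ?_⟩
  have h1 : ∀ a : A, ‖a‖ ≤ 1 → ‖ρ.π a * ρ.S‖ ≤ Real.sqrt C := fun a ha => by
    refine Real.le_sqrt_of_sq_le ?_
    have h2 : star (ρ.π a * ρ.S) * (ρ.π a * ρ.S) = ρ.π (φ (star a * a)) := by
      rw [← ρ.rel, star_mul, map_mul, map_star]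
      simp only [mul_assoc]
    rw [sq, ← CStarRing.norm_star_mul_self, h2]
    calc ‖ρ.π (φ (star a * a))‖ ≤ ‖φ (star a * a)‖ := NonUnitalStarAlgHom.norm_apply_le ρ.π _
      _ ≤ C * ‖star a * a‖ := hC _
      _ ≤ C * 1 := by
        gcongr
        rw [CStarRing.norm_star_mul_self]
        exact mul_le_one₀ ha (norm_nonneg _) ha
      _ = C := mul_one _
  have hu := CStarAlgebra.increasingApproximateUnit A
  have := hu.neBot
  have hcont : Continuous ρ.π :=
    AddMonoidHomClass.continuous_of_bound ρ.π 1 fun a => by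
      rw [one_mul]; exact NonUnitalStarAlgHom.norm_apply_le ρ.π a
  have hconv : ∀ v : ρ.H, Filter.Tendsto (fun e => ρ.π e v) (CStarAlgebra.approximateUnit A)
      (𝓝 v) := by
    intro v
    have hv : v ∈ (Submodule.span ℂ {v : ρ.H | ∃ a h, v = ρ.π a h}).topologicalClosure := by
      rw [ρ.nondegenerate]; trivial
    have hspan : ∀ w ∈ Submodule.span ℂ {v : ρ.H | ∃ a h, v = ρ.π a h},
        Filter.Tendsto (fun e => ρ.π e w) (CStarAlgebra.approximateUnit A) (𝓝 w) := by
      intro w hw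
      induction hw using Submodule.span_induction with
      | mem x hx =>
        obtain ⟨a, h, rfl⟩ := hx
        have h3 := (((ContinuousLinearMap.apply ℂ ρ.H h).continuous.comp hcont).tendsto a).comp
          (hu.tendsto_mul_right a)
        refine h3.congr fun e => ?_
        simp [map_mul]
      | zero => simp
      | add x y _ _ hx hy => simpa using hx.add hy
      | smul c x _ hx => simpa using hx.const_smul c
    rw [Metric.tendsto_nhds]
    intro ε hε
    obtain ⟨w, hw, hvw⟩ := Metric.mem_closure_iff.1 hv (ε / 3) (by positivity)
    filter_upwards [Metric.tendsto_nhds.1 (hspan w hw) (ε / 3) (by positivity),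
      hu.eventually_norm] with e he he1
    have h4 : dist (ρ.π e v) (ρ.π e w) < ε / 3 := by
      rw [dist_eq_norm, ← map_sub]
      refine lt_of_le_of_lt ?_ hvw
      rw [dist_eq_norm]
      refine ((ρ.π e).le_opNorm _).trans ?_
      exact mul_le_of_le_one_left (norm_nonneg _)
        ((NonUnitalStarAlgHom.norm_apply_le ρ.π e).trans he1)
    calc dist (ρ.π e v) v ≤ dist (ρ.π e v) (ρ.π e w) + dist (ρ.π e w) w + dist w v :=
          dist_triangle4 _ _ _ _
      _ < ε := by rw [dist_comm w v]; linarith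
  refine ContinuousLinearMap.opNorm_le_bound _ (Real.sqrt_nonneg _) fun h => ?_
  refine le_of_tendsto (hconv (ρ.S h)).norm ?_
  filter_upwards [hu.eventually_norm] with e he
  calc ‖ρ.π e (ρ.S h)‖ = ‖(ρ.π e * ρ.S) h‖ := rfl
    _ ≤ ‖ρ.π e * ρ.S‖ * ‖h‖ := ContinuousLinearMap.le_opNorm _ _
    _ ≤ _ := by gcongr; exact h1 e he

/-! ### Universal representations and Toeplitz algebras -/

section Universal

variable {φ : A →ₚ[ℂ] A} (R : Set (Rep φ))

/-- The C*-algebra `∏ B(H_ρ)` of bounded families, indexed by the representations `ρ` in `R`. -/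
def ProdAlg : Type (u + 1) := lp (fun ρ : R => ρ.1.H →L[ℂ] ρ.1.H) ∞

instance : NonUnitalCStarAlgebra (ProdAlg R) :=
  inferInstanceAs (NonUnitalCStarAlgebra (lp (fun ρ : R => ρ.1.H →L[ℂ] ρ.1.H) ∞))

/-- The coordinate homomorphism `∏ B(H_ρ) → B(H_ρ)`. -/
def ProdAlg.coord (ρ : R) : ProdAlg R →⋆ₙₐ[ℂ] (ρ.1.H →L[ℂ] ρ.1.H) where
  toFun x := x.1 ρ
  map_smul' _ _ := rfl
  map_zero' := rfl
  map_add' _ _ := rfl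
  map_mul' _ _ := rfl
  map_star' _ := rfl

variable {R} in
theorem ProdAlg.ext {x y : ProdAlg R} (h : ∀ ρ : R, coord R ρ x = coord R ρ y) : x = y :=
  Subtype.ext (funext h)

/-- The homomorphism `i_A : A → ∏ B(H_ρ)`, `a ↦ (π_ρ(a))_ρ`, of the universal representation
`(i_A, t)` for the class `R`. -/
def iA : A →⋆ₙₐ[ℂ] ProdAlg R where
  toFun a := ⟨fun ρ => ρ.1.π a, memℓp_infty ⟨‖a‖, by
    rintro _ ⟨ρ, rfl⟩
    exact NonUnitalStarAlgHom.norm_apply_le ρ.1.π a⟩⟩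
  map_smul' c a := by refine ProdAlg.ext fun ρ => ?_; exact map_smul ρ.1.π c a
  map_zero' := by refine ProdAlg.ext fun ρ => ?_; exact map_zero ρ.1.π
  map_add' a b := by refine ProdAlg.ext fun ρ => ?_; exact map_add ρ.1.π a b
  map_mul' a b := by refine ProdAlg.ext fun ρ => ?_; exact map_mul ρ.1.π a b
  map_star' a := by refine ProdAlg.ext fun ρ => ?_; exact map_star ρ.1.π a

/-- The operator `t = (S_ρ)_ρ` of the universal representation `(i_A, t)` for the class `R`. -/
def tOp : ProdAlg R :=
  ⟨fun ρ => ρ.1.S, memℓp_infty (by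
    obtain ⟨C, hC⟩ := Rep.exists_norm_S_le φ
    refine ⟨C, ?_⟩
    rintro _ ⟨ρ, rfl⟩
    exact hC ρ.1)⟩

/-- The C*-algebra generated by `i_A(A) ∪ i_A(A) t`, for the universal representation `(i_A, t)` of
the class `R`. -/
def toeplitz : NonUnitalStarSubalgebra ℂ (ProdAlg R) :=
  (NonUnitalStarAlgebra.adjoin ℂ
    (Set.range (iA R) ∪ Set.range fun a => iA R a * tOp R)).topologicalClosure

instance : NonUnitalCStarAlgebra (toeplitz R) :=
  haveI : IsClosed (toeplitz R : Set (ProdAlg R)) :=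
    NonUnitalStarSubalgebra.isClosed_topologicalClosure _
  inferInstance

/-- `i_A(a)` as an element of the Toeplitz algebra. -/
def toeplitzA (a : A) : toeplitz R :=
  ⟨iA R a, NonUnitalStarSubalgebra.le_topologicalClosure _
    (NonUnitalStarAlgebra.subset_adjoin ℂ _ (Or.inl ⟨a, rfl⟩))⟩

/-- `i_A(a) t` as an element of the Toeplitz algebra. -/
def toeplitzAt (a : A) : toeplitz R :=
  ⟨iA R a * tOp R, NonUnitalStarSubalgebra.le_topologicalClosure _
    (NonUnitalStarAlgebra.subset_adjoin ℂ _ (Or.inr ⟨a, rfl⟩))⟩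

/-- Universality: every representation `(π, S)` in the class `R` is the image of `(i_A, t)` under a
homomorphism. -/
theorem toeplitz_universal (ρ : Rep φ) (hρ : ρ ∈ R) :
    ∃ Ψ : toeplitz R →⋆ₙₐ[ℂ] (ρ.H →L[ℂ] ρ.H),
      (∀ a, Ψ (toeplitzA R a) = ρ.π a) ∧ ∀ a, Ψ (toeplitzAt R a) = ρ.π a * ρ.S :=
  ⟨(ProdAlg.coord R ⟨ρ, hρ⟩).comp (NonUnitalStarSubalgebraClass.subtype (toeplitz R)),
    fun _ => rfl, fun _ => rfl⟩

/-- The closed linear span of `i_A(A) t i_A(A) t* i_A(A)`. -/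
def spanASASA : Submodule ℂ (ProdAlg R) :=
  (Submodule.span ℂ {x | ∃ a b c, x = iA R a * tOp R * iA R b * star (tOp R) * iA R c}
    ).topologicalClosure

/-- The closed linear span of `i_A(A) t t* i_A(A)`. -/
def spanASSA : Submodule ℂ (ProdAlg R) :=
  (Submodule.span ℂ {x | ∃ a c, x = iA R a * tOp R * star (tOp R) * iA R c}).topologicalClosure

/-- `(i_A(a), k)` is a redundancy of `(i_A, t)`, where `M` is the space in which `k` has to lie:
`i_A(a) i_A(b) t = k i_A(b) t` for all `b ∈ A`. -/
def IsRedundancy (M : Submodule ℂ (ProdAlg R)) (a : A) (k : ProdAlg R) : Prop :=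
  k ∈ M ∧ ∀ b, iA R a * iA R b * tOp R = k * iA R b * tOp R

/-- The ideal of the Toeplitz algebra generated by all `i_A(a) - k` such that `a ∈ J` and
`(i_A(a), k)` is a redundancy. -/
def redundancyIdeal (M : Submodule ℂ (ProdAlg R)) (J : Set A) : ClosedIdeal (toeplitz R) :=
  ClosedIdeal.generate
    {z | ∃ a ∈ J, ∃ k, IsRedundancy R M a k ∧ (z : ProdAlg R) = iA R a - k}

end Universal

/-! ### Crossed products by a completely positive map -/

/-- `C*(A, φ; J)`: the quotient of the Toeplitz algebra of `(A, φ)` by the ideal generated by all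
`i_A(a) - k` with `a ∈ J` and `(i_A(a), k)` a redundancy, `k ∈ closed span of i_A(A)t i_A(A)t* i_A(A)`.
(It is used for completely positive `φ` and ideals `J` of `A`.) -/
def RelCrossedProduct (φ : A →ₚ[ℂ] A) (J : Set A) : Type (u + 1) :=
  CStarQuotient (redundancyIdeal (Set.univ : Set (Rep φ)) (spanASASA Set.univ) J)

instance (φ : A →ₚ[ℂ] A) (J : Set A) : NonUnitalCStarAlgebra (RelCrossedProduct φ J) :=
  inferInstanceAs (NonUnitalCStarAlgebra (CStarQuotient _))

/-- The image `j_A(a)` of `a` in `C*(A, φ; J)`. -/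
def RelCrossedProduct.jA (φ : A →ₚ[ℂ] A) (J : Set A) (a : A) : RelCrossedProduct φ J :=
  CStarQuotient.mk _ (toeplitzA _ a)

/-- The image `j_A(a) s` of `i_A(a) t` in `C*(A, φ; J)`. -/
def RelCrossedProduct.jAs (φ : A →ₚ[ℂ] A) (J : Set A) (a : A) : RelCrossedProduct φ J :=
  CStarQuotient.mk _ (toeplitzAt _ a)

/-- The GNS-kernel `N_φ = {a : φ((ab)*ab) = 0 for all b}`. -/
def gnsKernel (φ : A →ₚ[ℂ] A) : Set A := {a | ∀ b, φ (star (a * b) * (a * b)) = 0}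

/-- The annihilator `I^⊥ = {a ∈ A : a I = 0}` in `A`. -/
def annihilator (I : Set A) : Set A := {a | ∀ x ∈ I, a * x = 0}

/-- The crossed product `C*(A, φ) = C*(A, φ; N_φ^⊥)`. -/
abbrev CrossedProduct (φ : A →ₚ[ℂ] A) : Type (u + 1) :=
  RelCrossedProduct φ (annihilator (gnsKernel φ))

/-! ### Exel systems -/

/-- The closed linear span of `A C A`. -/
def closedSpanACA (C : Set A) : Set A :=
  (Submodule.span ℂ {x : A | ∃ a, ∃ c ∈ C, ∃ b, x = a * c * b}).topologicalClosure

/-- `(A, α, L)` is an Exel system, i.e. the positive linear map `L` is a transfer operator for the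
endomorphism `α`. -/
def IsExelSystem (α : A →⋆ₙₐ[ℂ] A) (L : A →ₚ[ℂ] A) : Prop :=
  ∀ a b, L (a * α b) = L a * b

/-- `E` is a conditional expectation onto `C`: a contractive linear idempotent with range `C`. -/
def IsConditionalExpectation (E : A →ₗ[ℂ] A) (C : Set A) : Prop :=
  Set.range E = C ∧ (∀ c ∈ C, E c = c) ∧ ∀ a, ‖E a‖ ≤ ‖a‖

/-- The linear map `α ∘ L`. -/
def compMap (α : A →⋆ₙₐ[ℂ] A) (L : A →ₚ[ℂ] A) : A →ₗ[ℂ] A where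
  toFun a := α (L a)
  map_add' a b := by rw [map_add, map_add]
  map_smul' c a := by rw [map_smul, map_smul]; rfl

/-- A regular Exel system: `α ∘ L` is a conditional expectation onto `α(A)`. -/
structure IsRegularExelSystem (α : A →⋆ₙₐ[ℂ] A) (L : A →ₚ[ℂ] A) : Prop where
  isExelSystem : IsExelSystem α L
  regular : IsConditionalExpectation (compMap α L) (Set.range α)

/-- `L` is faithful on `C`: `a ∈ C` and `L(a*a) = 0` imply `a = 0`. -/
def IsFaithfulOn (L : A →ₚ[ℂ] A) (C : Set A) : Prop :=
  ∀ a ∈ C, L (star a * a) = 0 → a = 0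

/-- The multiplicative domain `MD(L)`. -/
def multDomain (L : A →ₚ[ℂ] A) : Set A :=
  {a | ∀ b, L b * L a = L (b * a) ∧ L a * L b = L (a * b)}

/-- The kernel of the restriction of `L` to `MD(L)`. -/
def kerOnMD (L : A →ₚ[ℂ] A) : Set A := {a ∈ multDomain L | L a = 0}

/-- `(ker L|_{MD(L)})^⊥`, the annihilator being taken in `MD(L)`. -/
def kerOnMDPerp (L : A →ₚ[ℂ] A) : Set A := {a ∈ multDomain L | ∀ x ∈ kerOnMD L, a * x = 0}

/-- The class of representations of `(A, α, L)`: pairs `(π, S)` with `S* π(a) S = π(L(a))` and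
`S π(a) = π(α(a)) S`. -/
def exelReps (α : A →⋆ₙₐ[ℂ] A) (L : A →ₚ[ℂ] A) : Set (Rep L) :=
  {ρ | ∀ a, ρ.S * ρ.π a = ρ.π (α a) * ρ.S}

/-- Exel's crossed product `A ×_{α,L} ℕ`: the quotient of the Toeplitz algebra of `(A, α, L)` by the
ideal generated by all `i_A(a) - k` with `a` in the closed span of `A α(A) A` and `(i_A(a), k)` a
redundancy, `k ∈ closed span of i_A(A) t t* i_A(A)`. -/
def ExelCrossedProduct (α : A →⋆ₙₐ[ℂ] A) (L : A →ₚ[ℂ] A) : Type (u + 1) :=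
  CStarQuotient (redundancyIdeal (exelReps α L) (spanASSA (exelReps α L))
    (closedSpanACA (Set.range α)))

instance (α : A →⋆ₙₐ[ℂ] A) (L : A →ₚ[ℂ] A) : NonUnitalCStarAlgebra (ExelCrossedProduct α L) :=
  inferInstanceAs (NonUnitalCStarAlgebra (CStarQuotient _))

/-- The image of `i_A(a)` in Exel's crossed product. -/
def ExelCrossedProduct.jA (α : A →⋆ₙₐ[ℂ] A) (L : A →ₚ[ℂ] A) (a : A) : ExelCrossedProduct α L :=
  CStarQuotient.mk _ (toeplitzA _ a)

/-- The image of `i_A(a) t` in Exel's crossed product. -/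
def ExelCrossedProduct.jAs (α : A →⋆ₙₐ[ℂ] A) (L : A →ₚ[ℂ] A) (a : A) : ExelCrossedProduct α L :=
  CStarQuotient.mk _ (toeplitzAt _ a)

end ExelCrossed

end

open ExelCrossed

namespace ExelCrossed

section

variable {A : Type u} [NonUnitalCStarAlgebra A] [PartialOrder A] [StarOrderedRing A]

/-! ### Exel systems -/

/-! The multiplicative domain of `L` contains `α(A)`, and `a ↦ a - α(L a)` maps it into itself.
Faithfulness of `L` makes every `α(a)` annihilate `ker L|_{MD(L)}`. Conversely, if `a` annihilates
this kernel, then `d = a - α(L a)` satisfies `d d* = 0`, because `d*` lies in the kernel and is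
killed by both terms of `d` (`range_eq_kerOnMDPerp`). So `L` determines the range of `α`. It also
determines `ker α`, which is the set of `b` with `L(A) b = 0`, and with the identity `α ∘ L ∘ α = α`
this determines `α` (`eq_of_range_eq`).

For the crossed products, the relation `S π(b) = π(α(b)) S` already follows from `S* π(a) S =
π(L(a))` (`exelReps_eq_univ`), so the two Toeplitz algebras are the same. The two spaces of
admissible `k` also coincide (`spanASSA_eq_spanASASA`). The quotients then differ only in the name
of the ideal `J`, and the description of `α(A)` identifies the ideals. -/

/-- Without a unit on the left, the product is reached as the limit of `e * c * x` along an
approximate unit. This brings `α(a) x` within the scope of faithfulness. -/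
theorem mul_mem_closedSpanACA {C : Set A} {c : A} (hc : c ∈ C) (x : A) :
    c * x ∈ closedSpanACA C := by
  have hu := CStarAlgebra.increasingApproximateUnit A
  have := hu.neBot
  refine mem_closure_of_tendsto (hu.tendsto_mul_right (c * x)) (Filter.Eventually.of_forall ?_)
  exact fun e => Submodule.subset_span ⟨e, c, hc, x, (mul_assoc _ _ _).symm⟩

theorem star_mem_multDomain {L : A →ₚ[ℂ] A} {a : A} (ha : a ∈ multDomain L) :
    star a ∈ multDomain L := fun b => by
  obtain ⟨h1, h2⟩ := ha (star b)
  constructor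
  · have := congrArg star h2
    simpa only [star_mul, ← map_star, star_star] using this
  · have := congrArg star h1
    simpa only [star_mul, ← map_star, star_star] using this

theorem sub_mem_multDomain {L : A →ₚ[ℂ] A} {a b : A} (ha : a ∈ multDomain L)
    (hb : b ∈ multDomain L) : a - b ∈ multDomain L := fun c => by
  simp only [map_sub, mul_sub, sub_mul, (ha c).1, (ha c).2, (hb c).1, (hb c).2, and_self]

namespace IsExelSystem

variable {α : A →⋆ₙₐ[ℂ] A} {L : A →ₚ[ℂ] A} (h : IsExelSystem α L)
include h

theorem map_range_mul (b a : A) : L (α b * a) = b * L a := by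
  have := congrArg star (h (star a) (star b))
  simpa only [← map_star, star_mul, star_star] using this

theorem apply_mul_eq_zero {b : A} (hb : α b = 0) (a : A) : L a * b = 0 := by
  rw [← h, hb, mul_zero, map_zero]

end IsExelSystem

/-! ### Regular systems: recovering `α` from `L`. -/

namespace IsRegularExelSystem

variable {α : A →⋆ₙₐ[ℂ] A} {L : A →ₚ[ℂ] A} (h : IsRegularExelSystem α L)
include h

theorem map_apply_map (a : A) : α (L (α a)) = α a := h.regular.2.1 (α a) ⟨a, rfl⟩

/-- Regularity puts `L(α(b)) - b` in `ker α`, and `L(A)` annihilates `ker α` from the left. -/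
theorem apply_mul_apply_map (a b : A) : L a * L (α b) = L a * b := by
  have h1 : α (L (α b) - b) = 0 := by rw [map_sub, h.map_apply_map, sub_self]
  have h2 := h.isExelSystem.apply_mul_eq_zero h1 a
  rwa [mul_sub, sub_eq_zero] at h2

/-- The right-hand side does not mention `α`, so two regular systems with the same `L` have the same
kernel. For the converse, `α(b)* α(b)` equals `α(L(α(b*) α(b))) = α(L(α(b*)) b)`. -/
theorem map_eq_zero_iff {b : A} : α b = 0 ↔ ∀ a, L a * b = 0 := by
  refine ⟨h.isExelSystem.apply_mul_eq_zero, fun hb => ?_⟩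
  rw [← CStarRing.star_mul_self_eq_zero_iff, ← map_star, ← map_mul, ← h.map_apply_map, map_mul,
    h.isExelSystem, hb, map_zero]

theorem apply_map_apply (a : A) : L (α (L a)) = L a := by
  have h1 : α (L (α (L a)) - L a) = 0 := by rw [map_sub, h.map_apply_map, sub_self]
  -- The difference `d` lies in `ker α` and in the range of `L`. The range is self-adjoint, so `d* d
  -- ∈ L(A) ker α = 0`.
  rw [← sub_eq_zero, ← CStarRing.star_mul_self_eq_zero_iff, ← map_sub, ← map_star]
  rw [← map_sub] at h1
  exact h.isExelSystem.apply_mul_eq_zero h1 _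

theorem map_mem_multDomain (a : A) : α a ∈ multDomain L := by
  have h1 : ∀ a b, L b * L (α a) = L (b * α a) := fun a b => by
    rw [h.apply_mul_apply_map, h.isExelSystem]
  refine fun b => ⟨h1 a b, ?_⟩
  have := congrArg star (h1 (star a) (star b))
  simpa only [← map_star, star_mul, star_star] using this

theorem range_eq_kerOnMDPerp (hf : IsFaithfulOn L (closedSpanACA (Set.range α))) :
    Set.range α = kerOnMDPerp L := by
  have h1 : ∀ a, α a ∈ kerOnMDPerp L := fun a => by
    refine ⟨h.map_mem_multDomain a, fun x hx => hf _ (mul_mem_closedSpanACA (Set.mem_range_self a) x) ?_⟩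
    -- The element `(α(a) x)* α(a) x` is some element times `x`; since `x` is in the multiplicative
    -- domain, its image under `L` has the factor `L x = 0`.
    rw [← mul_assoc, ← (hx.1 _).1, hx.2, mul_zero]
  refine Set.Subset.antisymm (Set.range_subset_iff.2 h1) fun a ha => ⟨L a, ?_⟩
  have h2 : star (a - α (L a)) ∈ kerOnMD L := by
    refine ⟨star_mem_multDomain (sub_mem_multDomain ha.1 (h1 _).1), ?_⟩
    rw [map_star, map_sub, h.apply_map_apply, sub_self, star_zero]
  have h3 : (a - α (L a)) * star (a - α (L a)) = 0 := by
    rw [sub_mul, ha.2 _ h2, (h1 _).2 _ h2, sub_zero]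
  rw [CStarRing.mul_star_self_eq_zero_iff, sub_eq_zero] at h3
  exact h3.symm

theorem eq_of_range_eq {α' : A →⋆ₙₐ[ℂ] A} (h' : IsRegularExelSystem α' L)
    (hr : Set.range α' = Set.range α) : α' = α := by
  ext b
  -- Equality of kernels gives `α'(b) = α'(L(α(b)))`; as `α(b)` lies in the range of `α'`, on which
  -- `α' ∘ L` is the identity, the right side is `α(b)`.
  have h1 : α' (L (α b) - b) = 0 := h'.map_eq_zero_iff.2 <| h.map_eq_zero_iff.1 <| by
    rw [map_sub, h.map_apply_map, sub_self]
  obtain ⟨c, hc⟩ : α b ∈ Set.range α' := hr ▸ ⟨b, rfl⟩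
  rw [map_sub, sub_eq_zero] at h1
  rw [← h1, ← hc, h'.map_apply_map]

end IsRegularExelSystem

/-! ### Representations -/

/-- Each `T v` is orthogonal to all `π(a) w`, and these span a dense subspace by non-degeneracy. -/
theorem Rep.eq_zero_of_forall_mul {L : A →ₚ[ℂ] A} (ρ : Rep L) {T : ρ.H →L[ℂ] ρ.H}
    (hT : ∀ a, ρ.π a * T = 0) : T = 0 := by
  ext v
  have h1 : (⊤ : Submodule ℂ ρ.H) ≤ (innerSL ℂ (T v)).ker := by
    rw [← ρ.nondegenerate]
    refine Submodule.topologicalClosure_minimal _ (Submodule.span_le.2 ?_)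
      (ContinuousLinearMap.isClosed_ker _)
    rintro _ ⟨a, w, rfl⟩
    change inner ℂ (T v) (ρ.π a w) = 0
    rw [← ContinuousLinearMap.adjoint_inner_left, ← ContinuousLinearMap.star_eq_adjoint, ← map_star]
    change inner ℂ ((ρ.π (star a) * T) v) w = 0
    rw [hT, zero_apply, inner_zero_left]
  exact inner_self_eq_zero.1 (show inner ℂ (T v) (T v) = 0 from h1 trivial)

/-- Every representation of `(A, L)` is a representation of `(A, α, L)`. -/
theorem IsExelSystem.exelReps_eq_univ {α : A →⋆ₙₐ[ℂ] A} {L : A →ₚ[ℂ] A}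
    (h : IsExelSystem α L) : exelReps α L = Set.univ := by
  refine Set.eq_univ_of_forall fun ρ b => sub_eq_zero.1 (ρ.eq_zero_of_forall_mul fun a => ?_)
  -- By the transfer identity and its adjoint, each of the four terms equals `π(b* L(a* a) b)` up to
  -- sign, and the signs `+ - - +` cancel.
  have h1 : star (ρ.π a * (ρ.S * ρ.π b - ρ.π (α b) * ρ.S)) *
      (ρ.π a * (ρ.S * ρ.π b - ρ.π (α b) * ρ.S)) =
      ρ.π (star b) * (star ρ.S * ρ.π (star a * a) * ρ.S) * ρ.π b
      - ρ.π (star b) * (star ρ.S * ρ.π (star a * a * α b) * ρ.S)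
      - (star ρ.S * ρ.π (α (star b) * (star a * a)) * ρ.S) * ρ.π b
      + star ρ.S * ρ.π (α (star b) * (star a * a * α b)) * ρ.S := by
    simp only [star_mul, star_sub, map_mul, map_star, mul_sub, sub_mul, mul_assoc]
    abel
  rw [← CStarRing.star_mul_self_eq_zero_iff, h1]
  simp only [ρ.rel, h.map_range_mul, h _ b]
  simp only [map_mul, mul_assoc]
  abel

/-! ### Comparing the two spaces of redundancies. -/

section Universal

variable {L : A →ₚ[ℂ] A} (R : Set (Rep L))

theorem star_tOp_mul_iA_mul_tOp (a : A) : star (tOp R) * iA R a * tOp R = iA R (L a) :=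
  ProdAlg.ext fun ρ => ρ.1.rel a

theorem tOp_mul_iA {α : A →⋆ₙₐ[ℂ] A} (hR : R ⊆ exelReps α L) (a : A) :
    tOp R * iA R a = iA R (α a) * tOp R :=
  ProdAlg.ext fun ρ => hR ρ.2 a

/-- With `x = i_A(a) t` and `c = L(a* a)`, one has `x* x = i_A(c)`. Hence `‖x i_A(e) - x‖² ≤ 2
‖i_A(c e - c)‖` for `‖e‖ ≤ 1`, so an approximate unit of `A` acts as one to the right of `t`, with
no help from `α`. -/
theorem tendsto_iA_mul_tOp_mul_iA (a : A) :
    Filter.Tendsto (fun e => iA R a * tOp R * iA R e) (CStarAlgebra.approximateUnit A)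
      (𝓝 (iA R a * tOp R)) := by
  have hu := CStarAlgebra.increasingApproximateUnit A
  set c := L (star a * a) with hc
  have hi : Continuous (iA R) := AddMonoidHomClass.continuous_of_bound (iA R) 1 fun a => by
    rw [one_mul]; exact NonUnitalStarAlgHom.norm_apply_le (iA R) a
  have h0 : Filter.Tendsto (fun e => 2 * ‖iA R (c * e - c)‖) (CStarAlgebra.approximateUnit A)
      (𝓝 0) := by
    have := (hi.tendsto 0).comp (tendsto_sub_nhds_zero_iff.2 (hu.tendsto_mul_left c))
    simpa using this.norm.const_mul 2
  have h1 : ∀ e, star (iA R a * tOp R * iA R e - iA R a * tOp R) *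
      (iA R a * tOp R * iA R e - iA R a * tOp R) =
      iA R (star e) * iA R (c * e - c) - iA R (c * e - c) := fun e => by
    have h2 : star (iA R a * tOp R) * (iA R a * tOp R) = iA R c := by
      rw [hc, ← star_tOp_mul_iA_mul_tOp, map_mul, map_star, star_mul]
      simp only [mul_assoc]
    rw [map_sub, map_mul, ← h2, map_star]
    generalize iA R a * tOp R = x
    simp only [star_mul, star_sub, mul_sub, sub_mul, mul_assoc]
    abel
  have h3 : Filter.Tendsto (fun e => ‖iA R a * tOp R * iA R e - iA R a * tOp R‖ ^ 2)
      (CStarAlgebra.approximateUnit A) (𝓝 0) := by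
    refine squeeze_zero' (Filter.Eventually.of_forall fun e => by positivity) ?_ h0
    filter_upwards [hu.eventually_norm] with e he
    rw [sq, ← CStarRing.norm_star_mul_self, h1]
    have h4 : ‖iA R (star e)‖ ≤ 1 :=
      (NonUnitalStarAlgHom.norm_apply_le (iA R) _).trans (by rwa [norm_star])
    calc _ ≤ ‖iA R (star e) * iA R (c * e - c)‖ + ‖iA R (c * e - c)‖ := norm_sub_le _ _
      _ ≤ 1 * ‖iA R (c * e - c)‖ + ‖iA R (c * e - c)‖ := by
        gcongr
        exact (norm_mul_le _ _).trans (by gcongr)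
      _ = _ := by ring
  rw [tendsto_iff_norm_sub_tendsto_zero]
  have := h3.sqrt
  simpa using this

/-- An approximate unit can be inserted between `t` and `t*`; conversely, a middle factor `i_A(b)`
moves left past `t` as `i_A(α(b))`. -/
theorem spanASSA_eq_spanASASA {α : A →⋆ₙₐ[ℂ] A} (hR : R ⊆ exelReps α L) :
    spanASSA R = spanASASA R := by
  refine le_antisymm ?_ (Submodule.topologicalClosure_mono (Submodule.span_mono ?_))
  · refine Submodule.topologicalClosure_minimal _ (Submodule.span_le.2 ?_)
      (Submodule.isClosed_topologicalClosure _)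
    rintro _ ⟨a, c, rfl⟩
    have := (CStarAlgebra.increasingApproximateUnit A).neBot
    refine mem_closure_of_tendsto
      (((tendsto_iA_mul_tOp_mul_iA R a).mul_const (star (tOp R))).mul_const (iA R c))
      (Filter.Eventually.of_forall fun e => Submodule.subset_span ⟨a, e, c, rfl⟩)
  · rintro _ ⟨a, b, c, rfl⟩
    refine ⟨a * α b, c, ?_⟩
    rw [mul_assoc (iA R a), tOp_mul_iA R hR, map_mul]
    simp only [mul_assoc]

end Universal

/-- The ambient algebra depends on the class of representations, so the spaces `M` and `M'` have
different types and are compared by `HEq`. Once the data are identified, the isomorphism is the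
identity. -/
theorem exists_equiv_quotient_redundancyIdeal {L : A →ₚ[ℂ] A} {R R' : Set (Rep L)} (hR : R = R')
    {M : Submodule ℂ (ProdAlg R)} {M' : Submodule ℂ (ProdAlg R')} (hM : HEq M M') {J J' : Set A}
    (hJ : J = J') :
    ∃ Φ : CStarQuotient (redundancyIdeal R M J) ≃⋆ₐ[ℂ] CStarQuotient (redundancyIdeal R' M' J'),
      (∀ a, Φ (CStarQuotient.mk _ (toeplitzA R a)) = CStarQuotient.mk _ (toeplitzA R' a)) ∧
      ∀ a, Φ (CStarQuotient.mk _ (toeplitzAt R a)) = CStarQuotient.mk _ (toeplitzAt R' a) := by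
  subst hR hM hJ
  exact ⟨StarAlgEquiv.refl ℂ _, fun _ => rfl, fun _ => rfl⟩

theorem IsExelSystem.exists_equiv_relCrossedProduct {α : A →⋆ₙₐ[ℂ] A} {L : A →ₚ[ℂ] A}
    (h : IsExelSystem α L) {J : Set A} (hJ : closedSpanACA (Set.range α) = J) :
    ∃ Φ : ExelCrossedProduct α L ≃⋆ₐ[ℂ] RelCrossedProduct L J,
      (∀ a, Φ (ExelCrossedProduct.jA α L a) = RelCrossedProduct.jA L J a) ∧
      ∀ a, Φ (ExelCrossedProduct.jAs α L a) = RelCrossedProduct.jAs L J a := by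
  have hR := h.exelReps_eq_univ
  have hM := spanASSA_eq_spanASASA (exelReps α L) subset_rfl
  refine exists_equiv_quotient_redundancyIdeal hR ?_ hJ
  rw [hM, hR]

end

end ExelCrossed

theorem mainTheorem8 {A : Type u} [NonUnitalCStarAlgebra A] [PartialOrder A] [StarOrderedRing A]
    (α : A →⋆ₙₐ[ℂ] A) (L : A →ₚ[ℂ] A) (hreg : IsRegularExelSystem α L)
    (hfaith : IsFaithfulOn L (closedSpanACA (Set.range α))) :
    -- the range of `α` is determined by `L`
    Set.range α = kerOnMDPerp L ∧
    -- `α` is determined by `L`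
    (∀ α' : A →⋆ₙₐ[ℂ] A, IsRegularExelSystem α' L →
      IsFaithfulOn L (closedSpanACA (Set.range α')) → α' = α) ∧
    -- equality with the relative crossed product: the canonical generators correspond
    (∃ Φ : ExelCrossedProduct α L ≃⋆ₐ[ℂ] RelCrossedProduct L (closedSpanACA (kerOnMDPerp L)),
      (∀ a, Φ (ExelCrossedProduct.jA α L a) = RelCrossedProduct.jA L _ a) ∧
      ∀ a, Φ (ExelCrossedProduct.jAs α L a) = RelCrossedProduct.jAs L _ a) ∧
    -- equality with the crossed product `C*(A, L)`
    (closedSpanACA (kerOnMDPerp L) = annihilator (gnsKernel L) →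
      ∃ Φ : ExelCrossedProduct α L ≃⋆ₐ[ℂ] CrossedProduct L,
        (∀ a, Φ (ExelCrossedProduct.jA α L a) = RelCrossedProduct.jA L _ a) ∧
        ∀ a, Φ (ExelCrossedProduct.jAs α L a) = RelCrossedProduct.jAs L _ a) := by
  have hr := hreg.range_eq_kerOnMDPerp hfaith
  refine ⟨hr, fun α' h' hf' => hreg.eq_of_range_eq h' ?_, ?_, fun hN => ?_⟩
  · rw [h'.range_eq_kerOnMDPerp hf', hr]
  · exact hreg.isExelSystem.exists_equiv_relCrossedProduct (by rw [hr])
  · exact hreg.isExelSystem.exists_equiv_relCrossedProduct (by rw [hr, hN])
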